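/- For $B\subset\mathbb R$ write $B/B=\{a/b : a,b\in B,\ b\ne 0\}$, $B/B-1=\{x-1 : x\in B/B\}$, and for $X,Y\subset\mathbb R$ write $XY=\{xy : x\in X,\ y\in Y\}$ and $X+1=\{x+1: x\in X\}$. Let $|X|\in\{0,1,2,\dots\}\cup\{\infty\}$ denote the number of elements of $X$. (1) There are $\varepsilon>0$ and $N$ such that for every finite set $A\subset\mathbb R$ with $|A|\ge N$ and $|AA|\le |A|^{1+\varepsilon}$ there is no set $B\subset\mathbb R$ with $|B\setminus\{0\}|>1$ and $A+1=B/B$. (2) There are absolute constants $c>0$ and $K>0$ such that for every set $B\subset\mathbb R$ with $|B\setminus\{0\}|>1$ one has $$|(B/B-1)(B/B-1)|\ \ge\ K\,|B/B|^{1+c}$$ (for infinite $B$ this is read as $\infty\ge\infty$). -/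

import Mathlib

open scoped Pointwise ENNReal

/-- The ratio set `B/B = {a/b : a, b ∈ B, b ≠ 0}`. -/
def ratioSet (B : Set ℝ) : Set ℝ :=
  {x | ∃ a ∈ B, ∃ b ∈ B, b ≠ 0 ∧ x = a / b}

/-- The shift `S + t = {s + t : s ∈ S}`. -/
def shiftSet (S : Set ℝ) (t : ℝ) : Set ℝ :=
  {x | ∃ s ∈ S, x = s + t}

/-! Write G = B \ {0}, n = |G|, and let D be the nonzero part of G/G - 1. Since (a/b - 1)/(c/b - 1)
= (a - b)/(c - b), the set R of such ratios over distinct a, b, c in G lies in D/D, hence RR lies in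
DD/DD, and Plünnecke–Ruzsa gives |RR| |D|^3 ≤ |DD|^4.

Two applications of Szemerédi–Trotter on a grid bound |RR| from below. Coincidences among the ratios
are collinear triples in G × G, so |R| is at least about n^2 / log n, which is nearly |D| because
|D| ≤ n^2. Also R is invariant under r ↦ 1 - r, so Elekes' argument gives |RR| ≫ |R|^(5/4).
Together, |DD| ≫ |D|^(33/32). This is (2), up to the points 0 and 1 of B/B; (1) follows on taking A
= B/B - 1.

Only square grids occur, so Szemerédi–Trotter has an elementary proof: cut the grid into cells, note
that a line meets few of them, and count pairs of points sharing a cell. -/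

/-- Cauchy–Schwarz for fibres: a map into a small set has many coincidences. -/
theorem card_sq_le_card_mul_card_coincidences {α β : Type*} [DecidableEq α] [DecidableEq β]
    (S : Finset α) (T : Finset β) (f : α → β) (hf : ∀ x ∈ S, f x ∈ T) :
    S.card ^ 2 ≤ T.card * ((S ×ˢ S).filter (fun p => f p.1 = f p.2)).card := by
  have h1 : S.card = ∑ t ∈ T, (S.filter (fun x => f x = t)).card :=
    Finset.card_eq_sum_card_fiberwise hf
  have h2 : ((S ×ˢ S).filter (fun p => f p.1 = f p.2)).card
      = ∑ t ∈ T, (S.filter (fun x => f x = t)).card ^ 2 := by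
    rw [Finset.card_eq_sum_card_fiberwise (f := fun p => f p.1) (t := T)]
    · refine Finset.sum_congr rfl fun t _ => ?_
      rw [sq, ← Finset.card_product]
      congr 1
      ext ⟨x, y⟩
      simp only [Finset.mem_filter, Finset.mem_product]
      constructor
      · rintro ⟨⟨⟨hx, hy⟩, h⟩, rfl⟩; exact ⟨⟨hx, rfl⟩, hy, h.symm⟩
      · rintro ⟨⟨hx, rfl⟩, hy, h⟩; exact ⟨⟨⟨hx, hy⟩, h.symm⟩, rfl⟩
    · intro p hp
      simp only [Finset.coe_filter, Finset.mem_product, Set.mem_ofPred_eq] at hp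
      exact hf _ hp.1.1
  rw [h2]
  conv_lhs => rw [h1]
  exact sq_sum_le_card_mul_sum_sq

/-! ### Szemerédi–Trotter for square grids. -/

/-- The index of the block containing `x` when `X` is cut, in increasing order, into blocks
of `s` elements. -/
noncomputable def blockIndex (X : Finset ℝ) (s : ℕ) (x : ℝ) : ℕ :=
  (X.filter (fun y => y < x)).card / s

theorem blockIndex_mono (X : Finset ℝ) (s : ℕ) : Monotone (blockIndex X s) := by
  intro x y hxy
  refine Nat.div_le_div_right (Finset.card_le_card ?_)
  intro z hz
  simp only [Finset.mem_filter] at hz ⊢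
  exact ⟨hz.1, hz.2.trans_le hxy⟩

theorem card_filter_lt_lt {X : Finset ℝ} {x y : ℝ} (hx : x ∈ X) (hxy : x < y) :
    (X.filter (fun z => z < x)).card < (X.filter (fun z => z < y)).card := by
  refine Finset.card_lt_card ?_
  rw [Finset.ssubset_iff_of_subset]
  · exact ⟨x, by simp [hx, hxy], by simp⟩
  · intro z hz
    simp only [Finset.mem_filter] at hz ⊢
    exact ⟨hz.1, hz.2.trans hxy⟩

theorem blockIndex_le {X : Finset ℝ} (s : ℕ) {x : ℝ} (hx : x ∈ X) :
    blockIndex X s x ≤ (X.card - 1) / s := by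
  refine Nat.div_le_div_right ?_
  have : (X.filter (fun y => y < x)).card < X.card := by
    refine Finset.card_lt_card ?_
    rw [Finset.ssubset_iff_of_subset (Finset.filter_subset _ _)]
    exact ⟨x, hx, by simp⟩
  omega

theorem card_blockIndex_fiber_le (X : Finset ℝ) {s : ℕ} (hs : 0 < s) (j : ℕ) :
    (X.filter (fun x => blockIndex X s x = j)).card ≤ s := by
  have h : (X.filter (fun x => blockIndex X s x = j)).card
      ≤ (Finset.Ico (j * s) (j * s + s)).card := by
    -- The rank of x is injective on X, and a block is an interval of s ranks.
    refine Finset.card_le_card_of_injOn (fun x => (X.filter (fun y => y < x)).card) ?_ ?_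
    · intro x hx
      rw [Finset.mem_coe, Finset.mem_filter] at hx
      simp only [blockIndex] at hx
      obtain ⟨_, rfl⟩ := hx
      simp only [Finset.coe_Ico, Set.mem_Ico]
      exact ⟨Nat.div_mul_le_self _ _, Nat.lt_div_mul_add hs⟩
    · intro x hx y hy hxy
      simp only [Finset.coe_filter, Set.mem_ofPred_eq] at hx hy
      rcases lt_trichotomy x y with h | h | h
      · exact absurd hxy (card_filter_lt_lt hx.1 h).ne
      · exact h
      · exact absurd hxy (card_filter_lt_lt hy.1 h).ne'
  simpa using h

theorem card_blockIndex_pairs_le (X : Finset ℝ) {s : ℕ} (hs : 0 < s) :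
    ((X ×ˢ X).filter (fun p => blockIndex X s p.1 = blockIndex X s p.2)).card ≤ X.card * s := by
  rw [Finset.card_eq_sum_card_fiberwise (f := Prod.fst) (t := X)]
  · rw [← smul_eq_mul]
    refine Finset.sum_le_card_nsmul _ _ _ fun x _ => ?_
    refine le_trans ?_ (card_blockIndex_fiber_le X hs (blockIndex X s x))
    refine Finset.card_le_card_of_injOn Prod.snd ?_ ?_
    · rintro ⟨a, b⟩ hp
      simp only [Finset.coe_filter, Finset.mem_filter, Finset.mem_product, Set.mem_ofPred_eq] at hp ⊢
      obtain ⟨⟨⟨_, hb⟩, h⟩, rfl⟩ := hp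
      exact ⟨hb, h.symm⟩
    · rintro ⟨a, b⟩ hp ⟨a', b'⟩ hp' h
      simp only [Finset.coe_filter, Finset.mem_filter, Set.mem_ofPred_eq] at hp hp' h
      rw [hp.2, hp'.2, h]
  · intro p hp
    simp only [Finset.coe_filter, Finset.mem_product, Set.mem_ofPred_eq] at hp
    exact hp.1.1

/-- Abscissae of the points of the grid `X × X` on the line `y = l.1 * x + l.2`. -/
noncomputable def gridLine (X : Finset ℝ) (l : ℝ × ℝ) : Finset ℝ :=
  X.filter (fun x => l.1 * x + l.2 ∈ X)

theorem mem_gridLine {X : Finset ℝ} {l : ℝ × ℝ} {x : ℝ} :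
    x ∈ gridLine X l ↔ x ∈ X ∧ l.1 * x + l.2 ∈ X := by simp [gridLine]

/-- Pairs of points of the grid on a given line that lie in the same cell. -/
noncomputable def cellPairs (X : Finset ℝ) (s : ℕ) (l : ℝ × ℝ) : Finset (ℝ × ℝ) :=
  (gridLine X l ×ˢ gridLine X l).filter (fun p =>
    blockIndex X s p.1 = blockIndex X s p.2 ∧
    blockIndex X s (l.1 * p.1 + l.2) = blockIndex X s (l.1 * p.2 + l.2))

/-- A line that is neither vertical nor horizontal meets few cells. -/
theorem card_gridLine_sq_le (X : Finset ℝ) (s : ℕ) (l : ℝ × ℝ) :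
    (gridLine X l).card ^ 2 ≤ (2 * ((X.card - 1) / s) + 1) * (cellPairs X s l).card := by
  set q := (X.card - 1) / s with hq
  -- Along a line both block indices are monotone, so a suitable sum of them, one index reversed
  -- when the slope is negative, takes at most 2q + 1 values and determines the cell.
  have key : ∃ h : ℝ → ℕ, (∀ x ∈ gridLine X l, h x ∈ Finset.range (2 * q + 1)) ∧
      ∀ x ∈ gridLine X l, ∀ y ∈ gridLine X l, h x = h y →
        blockIndex X s x = blockIndex X s y ∧
        blockIndex X s (l.1 * x + l.2) = blockIndex X s (l.1 * y + l.2) := by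
    have mono := blockIndex_mono X s
    rcases le_total 0 l.1 with hm | hm
    · refine ⟨fun x => blockIndex X s x + blockIndex X s (l.1 * x + l.2), ?_, ?_⟩
      · intro x hx
        rw [mem_gridLine] at hx
        have h1 := blockIndex_le s hx.1
        have h2 := blockIndex_le s hx.2
        simp only [Finset.mem_range]
        omega
      · intro x _ y _ h
        dsimp only at h
        rcases le_total x y with hxy | hxy
        · have h1 := mono hxy
          have h2 := mono (show l.1 * x + l.2 ≤ l.1 * y + l.2 by nlinarith)
          omega
        · have h1 := mono hxy
          have h2 := mono (show l.1 * y + l.2 ≤ l.1 * x + l.2 by nlinarith)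
          omega
    · refine ⟨fun x => blockIndex X s x + (q - blockIndex X s (l.1 * x + l.2)), ?_, ?_⟩
      · intro x hx
        rw [mem_gridLine] at hx
        have h1 := blockIndex_le s hx.1
        simp only [Finset.mem_range]
        omega
      · intro x hx y hy h
        dsimp only at h
        rw [mem_gridLine] at hx hy
        have h3 := blockIndex_le s hx.2
        have h4 := blockIndex_le s hy.2
        rcases le_total x y with hxy | hxy
        · have h1 := mono hxy
          have h2 := mono (show l.1 * y + l.2 ≤ l.1 * x + l.2 by nlinarith)
          omega
        · have h1 := mono hxy
          have h2 := mono (show l.1 * x + l.2 ≤ l.1 * y + l.2 by nlinarith)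
          omega
  obtain ⟨h, h1, h2⟩ := key
  refine (card_sq_le_card_mul_card_coincidences _ _ h h1).trans ?_
  rw [Finset.card_range]
  refine Nat.mul_le_mul_left _ (Finset.card_le_card ?_)
  rintro ⟨x, y⟩ hp
  simp only [Finset.mem_filter, Finset.mem_product, cellPairs] at hp ⊢
  exact ⟨hp.1, h2 x hp.1.1 y hp.1.2 hp.2⟩

/-- Two distinct points determine the line, so each pair of points sharing a cell is counted at most
once over all of `L`. -/
theorem sum_card_cellPairs_offDiag_le (X : Finset ℝ) {s : ℕ} (hs : 0 < s) (L : Finset (ℝ × ℝ)) :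
    ∑ l ∈ L, ((cellPairs X s l).filter (fun p => p.1 ≠ p.2)).card ≤ (X.card * s) ^ 2 := by
  rw [← Finset.card_sigma, sq]
  refine le_trans ?_ (Nat.mul_le_mul (card_blockIndex_pairs_le X hs) (card_blockIndex_pairs_le X hs))
  rw [← Finset.card_product]
  refine Finset.card_le_card_of_injOn
    (fun z => (z.2, (z.1.1 * z.2.1 + z.1.2, z.1.1 * z.2.2 + z.1.2))) ?_ ?_
  · rintro ⟨l, x, y⟩ hz
    simp only [Finset.coe_sigma, Set.mem_sigma_iff, Finset.mem_coe, Finset.mem_filter, cellPairs,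
      Finset.mem_product, mem_gridLine] at hz ⊢
    tauto
  · rintro ⟨⟨m, t⟩, x, y⟩ hz ⟨⟨m', t'⟩, x', y'⟩ hz' h
    simp only [Finset.coe_sigma, Set.mem_sigma_iff, Finset.mem_coe, Finset.mem_filter] at hz
    simp only [Prod.mk.injEq] at h
    obtain ⟨⟨rfl, rfl⟩, h1, h2⟩ := h
    have hne : x - y ≠ 0 := sub_ne_zero.2 hz.2.2
    have hm : m = m' := by
      apply mul_right_cancel₀ hne; linarith
    subst hm
    have ht : t = t' := by linarith
    subst ht
    rfl

/-- Szemerédi–Trotter bound for the number of rich lines of a square grid. -/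
theorem card_richLines_mul_cube_le (X : Finset ℝ) {k : ℕ} (hk : 2 ≤ k) (L : Finset (ℝ × ℝ))
    (hL : ∀ l ∈ L, k ≤ (gridLine X l).card) : L.card * k ^ 3 ≤ 81 * X.card ^ 4 := by
  rcases L.eq_empty_or_nonempty with rfl | ⟨l₀, hl₀⟩
  · simp
  have hkn : k ≤ X.card := (hL _ hl₀).trans (Finset.card_le_card (Finset.filter_subset _ _))
  set n := X.card with hn
  -- Blocks just large enough that a line meets at most k/2 cells; then at least half of its
  -- same-cell pairs are off the diagonal.
  set s := 8 * n / k + 1 with hs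
  have hsk : s * k ≤ 9 * n := by
    have := Nat.div_mul_le_self (8 * n) k
    rw [hs, add_mul]; omega
  have hsk' : 8 * n < s * k := by
    rw [mul_comm s k, hs]; exact Nat.lt_mul_div_succ _ (by omega)
  have hq : 2 * (2 * ((n - 1) / s) + 1) ≤ k := by
    set q := (n - 1) / s
    have h1 : q * s ≤ n - 1 := Nat.div_mul_le_self _ _
    rcases Nat.eq_zero_or_pos q with h0 | h0
    · omega
    · by_contra hcon
      push Not at hcon
      have h2 : k + 1 ≤ 6 * q := by omega
      have h3 : s * k ≤ s * (6 * q) := Nat.mul_le_mul_left _ (by omega)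
      have h4 : s * (6 * q) = 6 * (q * s) := by ring
      omega
  have hline : ∀ l ∈ L, k ≤ ((cellPairs X s l).filter (fun p => p.1 ≠ p.2)).card := by
    intro l hl
    have h1 := card_gridLine_sq_le X s l
    have h2 := hL l hl
    set i := (gridLine X l).card with hi
    have h3 : (cellPairs X s l).card
        ≤ ((cellPairs X s l).filter (fun p => p.1 ≠ p.2)).card + i := by
      rw [← Finset.card_filter_add_card_filter_not (s := cellPairs X s l) (fun p => p.1 ≠ p.2)]
      refine Nat.add_le_add_left ?_ _
      refine Finset.card_le_card_of_injOn Prod.fst ?_ ?_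
      · rintro ⟨x, y⟩ hp
        simp only [Finset.coe_filter, cellPairs, Finset.mem_filter, Finset.mem_product,
          Set.mem_ofPred_eq] at hp
        exact hp.1.1.1
      · rintro ⟨x, y⟩ hp ⟨x', y'⟩ hp' h
        simp only [Finset.coe_filter, Set.mem_ofPred_eq, not_not] at hp hp' h
        rw [← hp.2, ← hp'.2, h]
    have h4 : i * i ≤ k * (cellPairs X s l).card / 2 := by
      rw [Nat.le_div_iff_mul_le (by norm_num)]
      calc i * i * 2 = 2 * i ^ 2 := by ring
        _ ≤ 2 * ((2 * ((n - 1) / s) + 1) * (cellPairs X s l).card) := Nat.mul_le_mul_left _ h1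
        _ = (2 * (2 * ((n - 1) / s) + 1)) * (cellPairs X s l).card := by ring
        _ ≤ _ := Nat.mul_le_mul_right _ hq
    have h5 : 2 * (i * i) ≤ k * (cellPairs X s l).card := by omega
    have h6 : k * (2 * i) ≤ k * (cellPairs X s l).card := by
      refine le_trans ?_ h5
      calc k * (2 * i) ≤ i * (2 * i) := Nat.mul_le_mul_right _ h2
        _ = _ := by ring
    have h7 := Nat.le_of_mul_le_mul_left h6 (by omega)
    omega
  have hsum : L.card * k ≤ (n * s) ^ 2 := by
    refine le_trans ?_ (sum_card_cellPairs_offDiag_le X (s := s) (Nat.succ_pos _) L)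
    rw [← smul_eq_mul]
    exact Finset.card_nsmul_le_sum _ _ _ hline
  calc L.card * k ^ 3 = (L.card * k) * k ^ 2 := by ring
    _ ≤ (n * s) ^ 2 * k ^ 2 := Nat.mul_le_mul_right _ hsum
    _ = n ^ 2 * (s * k) ^ 2 := by ring
    _ ≤ n ^ 2 * (9 * n) ^ 2 := Nat.mul_le_mul_left _ (Nat.pow_le_pow_left hsk 2)
    _ = 81 * n ^ 4 := by ring

/-- Dyadic decomposition by richness: each class 2^j ≤ |line| < 2^(j+1) contributes at most 8 · 81 ·
|X|^4, and j = 0 is empty. -/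
theorem sum_card_gridLine_cube_le (X : Finset ℝ) (L : Finset (ℝ × ℝ))
    (hL : ∀ l ∈ L, 2 ≤ (gridLine X l).card) :
    ∑ l ∈ L, (gridLine X l).card ^ 3 ≤ 648 * X.card ^ 4 * (Nat.log 2 X.card + 1) := by
  have hmaps : ∀ l ∈ L, Nat.log 2 (gridLine X l).card ∈ Finset.range (Nat.log 2 X.card + 1) := by
    intro l _
    rw [Finset.mem_range, Nat.lt_succ_iff]
    exact Nat.log_mono_right (Finset.card_le_card (Finset.filter_subset _ _))
  rw [← Finset.sum_fiberwise_of_maps_to hmaps, mul_comm (648 * _)]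
  conv_rhs => rw [← Finset.card_range (Nat.log 2 X.card + 1), ← smul_eq_mul]
  refine Finset.sum_le_card_nsmul _ _ _ fun j _ => ?_
  rcases Nat.eq_zero_or_pos j with rfl | hj
  · rw [Finset.sum_eq_zero]
    · exact Nat.zero_le _
    · intro l hl
      rw [Finset.mem_filter] at hl
      have h2 := hL l hl.1
      have := Nat.log_pos (b := 2) (by norm_num) h2
      omega
  have hj2 : 2 ≤ 2 ^ j := by
    calc 2 = 2 ^ 1 := by norm_num
      _ ≤ 2 ^ j := Nat.pow_le_pow_right (by norm_num) hj
  have hrich := card_richLines_mul_cube_le X hj2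
    (L.filter fun l => Nat.log 2 (gridLine X l).card = j) (by
      intro l hl
      rw [Finset.mem_filter] at hl
      rw [← hl.2]
      exact Nat.pow_log_le_self 2 (by have := hL l hl.1; omega))
  calc _ ≤ (L.filter fun l => Nat.log 2 (gridLine X l).card = j).card • (2 ^ (j + 1)) ^ 3 := by
        refine Finset.sum_le_card_nsmul _ _ _ fun l hl => ?_
        rw [Finset.mem_filter] at hl
        refine Nat.pow_le_pow_left ?_ 3
        rw [← hl.2]
        exact (Nat.lt_pow_succ_log_self (by norm_num) _).le
    _ = 8 * ((L.filter fun l => Nat.log 2 (gridLine X l).card = j).card * (2 ^ j) ^ 3) := by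
        rw [smul_eq_mul, pow_succ 2 j]; ring
    _ ≤ 8 * (81 * X.card ^ 4) := Nat.mul_le_mul_left _ hrich
    _ = _ := by ring

/-! ### Ratios of differences. -/

/-- Triples of distinct elements of `G`. -/
noncomputable def distinctTriples (G : Finset ℝ) : Finset (ℝ × ℝ × ℝ) :=
  (G ×ˢ G ×ˢ G).filter fun p => p.1 ≠ p.2.1 ∧ p.2.2 ≠ p.2.1 ∧ p.1 ≠ p.2.2

noncomputable def tripleRatio (p : ℝ × ℝ × ℝ) : ℝ := (p.1 - p.2.1) / (p.2.2 - p.2.1)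

/-- The set of ratios `(a - b) / (c - b)` with `a, b, c` distinct elements of `G`. -/
noncomputable def tripleRatios (G : Finset ℝ) : Finset ℝ := (distinctTriples G).image tripleRatio

theorem mem_tripleRatios {G : Finset ℝ} {r : ℝ} : r ∈ tripleRatios G ↔
    ∃ a ∈ G, ∃ b ∈ G, ∃ c ∈ G, a ≠ b ∧ c ≠ b ∧ a ≠ c ∧ (a - b) / (c - b) = r := by
  simp only [tripleRatios, distinctTriples, tripleRatio, Finset.mem_image, Finset.mem_filter,
    Finset.mem_product, Prod.exists]
  constructor
  · rintro ⟨a, b, c, ⟨⟨ha, hb, hc⟩, h1, h2, h3⟩, h⟩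
    exact ⟨a, ha, b, hb, c, hc, h1, h2, h3, h⟩
  · rintro ⟨a, ha, b, hb, c, hc, h1, h2, h3, h⟩
    exact ⟨a, b, c, ⟨⟨ha, hb, hc⟩, h1, h2, h3⟩, h⟩

theorem zero_notMem_tripleRatios (G : Finset ℝ) : (0 : ℝ) ∉ tripleRatios G := by
  rw [mem_tripleRatios]
  rintro ⟨a, _, b, _, c, _, h1, h2, _, h⟩
  exact div_ne_zero (sub_ne_zero.2 h1) (sub_ne_zero.2 h2) h

/-- Exchanging b and c turns r into 1 - r; this needs a ≠ c. -/
theorem one_sub_mem_tripleRatios {G : Finset ℝ} {r : ℝ} (hr : r ∈ tripleRatios G) :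
    1 - r ∈ tripleRatios G := by
  rw [mem_tripleRatios] at hr ⊢
  obtain ⟨a, ha, b, hb, c, hc, h1, h2, h3, rfl⟩ := hr
  refine ⟨a, ha, c, hc, b, hb, h3, h2.symm, h1, ?_⟩
  have h4 : c - b ≠ 0 := sub_ne_zero.2 h2
  have h5 : b - c ≠ 0 := sub_ne_zero.2 h2.symm
  field_simp
  ring

theorem card_cube_le_card_distinctTriples (G : Finset ℝ) :
    G.card ^ 3 ≤ (distinctTriples G).card + 3 * G.card ^ 2 := by
  have hsub : G ×ˢ G ×ˢ G ⊆ distinctTriples G ∪ ((G ×ˢ G).image (fun p => (p.1, p.1, p.2)) ∪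
      ((G ×ˢ G).image (fun p => (p.1, p.2, p.2)) ∪
        (G ×ˢ G).image (fun p => (p.1, p.2, p.1)))) := by
    rintro ⟨a, b, c⟩ h
    simp only [Finset.mem_union, Finset.mem_image, distinctTriples, Finset.mem_filter,
      Finset.mem_product, Prod.exists, Prod.mk.injEq] at h ⊢
    by_cases h1 : a = b
    · exact Or.inr (Or.inl ⟨a, c, ⟨h.1, h.2.2⟩, rfl, h1, rfl⟩)
    by_cases h2 : c = b
    · exact Or.inr (Or.inr (Or.inl ⟨a, b, ⟨h.1, h.2.1⟩, rfl, rfl, h2.symm⟩))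
    by_cases h3 : a = c
    · exact Or.inr (Or.inr (Or.inr ⟨a, b, ⟨h.1, h.2.1⟩, rfl, rfl, h3⟩))
    exact Or.inl ⟨h, h1, h2, h3⟩
  have hcard := Finset.card_le_card hsub
  have u1 := Finset.card_union_le (distinctTriples G) ((G ×ˢ G).image (fun p => (p.1, p.1, p.2)) ∪
      ((G ×ˢ G).image (fun p => (p.1, p.2, p.2)) ∪ (G ×ˢ G).image (fun p => (p.1, p.2, p.1))))
  have u2 := Finset.card_union_le ((G ×ˢ G).image (fun p => (p.1, p.1, p.2)))
      ((G ×ˢ G).image (fun p => (p.1, p.2, p.2)) ∪ (G ×ˢ G).image (fun p => (p.1, p.2, p.1)))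
  have u3 := Finset.card_union_le ((G ×ˢ G).image (fun p => (p.1, p.2, p.2)))
      ((G ×ˢ G).image (fun p => (p.1, p.2, p.1)))
  have i1 := Finset.card_image_le (s := G ×ˢ G) (f := fun p => (p.1, p.1, p.2))
  have i2 := Finset.card_image_le (s := G ×ˢ G) (f := fun p => (p.1, p.2, p.2))
  have i3 := Finset.card_image_le (s := G ×ˢ G) (f := fun p => (p.1, p.2, p.1))
  rw [Finset.card_product] at i1 i2 i3
  rw [Finset.card_product, Finset.card_product] at hcard
  rw [pow_succ', sq]
  omega

/-- Pairs of triples with equal ratios correspond to collinear triples in the grid. -/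
theorem card_tripleRatio_coincidences_le (G : Finset ℝ) :
    ((distinctTriples G ×ˢ distinctTriples G).filter
      (fun p => tripleRatio p.1 = tripleRatio p.2)).card
      ≤ 648 * G.card ^ 4 * (Nat.log 2 G.card + 1) := by
  set E := (distinctTriples G ×ˢ distinctTriples G).filter
      (fun p => tripleRatio p.1 = tripleRatio p.2) with hE
  -- The line through (b, b') and (c, c'); equality of the ratios says that it also contains (a,
  -- a').
  let line : (ℝ × ℝ × ℝ) × (ℝ × ℝ × ℝ) → ℝ × ℝ := fun p =>
    ((p.2.2.2 - p.2.2.1) / (p.1.2.2 - p.1.2.1),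
      p.2.2.1 - (p.2.2.2 - p.2.2.1) / (p.1.2.2 - p.1.2.1) * p.1.2.1)
  have key : ∀ p ∈ E, (p.1.1 ∈ G ∧ p.1.2.1 ∈ G ∧ p.1.2.2 ∈ G) ∧
      (p.2.1 ∈ G ∧ p.2.2.1 ∈ G ∧ p.2.2.2 ∈ G) ∧ p.1.2.2 ≠ p.1.2.1 ∧
      (line p).1 * p.1.1 + (line p).2 = p.2.1 ∧
      (line p).1 * p.1.2.1 + (line p).2 = p.2.2.1 ∧
      (line p).1 * p.1.2.2 + (line p).2 = p.2.2.2 := by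
    rintro ⟨⟨a, b, c⟩, a', b', c'⟩ hp
    rw [hE, Finset.mem_filter, Finset.mem_product] at hp
    simp only [distinctTriples, Finset.mem_filter, Finset.mem_product, tripleRatio] at hp
    obtain ⟨⟨⟨h, -, hcb, -⟩, ⟨h', -, hcb', -⟩⟩, heq⟩ := hp
    have e1 : c - b ≠ 0 := sub_ne_zero.2 hcb
    have e2 : c' - b' ≠ 0 := sub_ne_zero.2 hcb'
    rw [div_eq_div_iff e1 e2] at heq
    refine ⟨h, h', hcb, ?_, ?_, ?_⟩ <;> simp only [line]
    · have : (c' - b') / (c - b) * a + (b' - (c' - b') / (c - b) * b)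
          = (a - b) * (c' - b') / (c - b) + b' := by ring
      rw [this, heq, mul_div_cancel_right₀ _ e1]; ring
    · ring
    · have : (c' - b') / (c - b) * c + (b' - (c' - b') / (c - b) * b)
          = (c' - b') * (c - b) / (c - b) + b' := by ring
      rw [this, mul_div_cancel_right₀ _ e1]; ring
  refine le_trans ?_ (sum_card_gridLine_cube_le G (E.image line) ?_)
  · have : ∀ l, (gridLine G l).card ^ 3
        = (gridLine G l ×ˢ gridLine G l ×ˢ gridLine G l).card := by
      intro l; rw [Finset.card_product, Finset.card_product]; ring
    simp only [this]
    rw [← Finset.card_sigma]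
    refine Finset.card_le_card_of_injOn (fun p => ⟨line p, p.1⟩) ?_ ?_
    · intro p hp
      obtain ⟨h1, h2, -, k1, k2, k3⟩ := key p hp
      simp only [Finset.coe_sigma, Set.mem_sigma_iff, Finset.mem_coe, Finset.mem_product,
        mem_gridLine, k1, k2, k3]
      exact ⟨Finset.mem_image_of_mem _ hp, ⟨h1.1, h2.1⟩, ⟨h1.2.1, h2.2.1⟩, h1.2.2, h2.2.2⟩
    · intro p hp p' hp' h
      obtain ⟨-, -, -, k1, k2, k3⟩ := key p hp
      obtain ⟨-, -, -, k1', k2', k3'⟩ := key p' hp'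
      simp only [Sigma.mk.injEq, heq_eq_eq] at h
      obtain ⟨hl, h1⟩ := h
      rw [← hl, ← h1] at k1' k2' k3'
      refine Prod.ext h1 (Prod.ext (k1.symm.trans k1') (Prod.ext (k2.symm.trans k2')
        (k3.symm.trans k3')))
  · intro l hl
    rw [Finset.mem_image] at hl
    obtain ⟨p, hp, rfl⟩ := hl
    obtain ⟨h1, h2, hne, k1, k2, k3⟩ := key p hp
    have : 1 < (gridLine G (line p)).card := by
      rw [Finset.one_lt_card]
      exact ⟨p.1.2.2, mem_gridLine.2 ⟨h1.2.2, by rw [k3]; exact h2.2.2⟩,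
        p.1.2.1, mem_gridLine.2 ⟨h1.2.1, by rw [k2]; exact h2.2.1⟩, hne⟩
    exact this

/-- Cauchy–Schwarz against the coincidence count; for n ≥ 6 at least half of all triples are
distinct. -/
theorem card_sq_le_card_tripleRatios_mul_log {G : Finset ℝ} (hG : 6 ≤ G.card) :
    G.card ^ 2 ≤ 2592 * (tripleRatios G).card * (Nat.log 2 G.card + 1) := by
  have h1 := card_cube_le_card_distinctTriples G
  have h2 := card_sq_le_card_mul_card_coincidences (distinctTriples G) (tripleRatios G) tripleRatio
    (fun x hx => Finset.mem_image_of_mem _ hx)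
  have h3 := h2.trans (Nat.mul_le_mul_left _ (card_tripleRatio_coincidences_le G))
  set n := G.card
  set T := (distinctTriples G).card
  set R := (tripleRatios G).card
  have h4 : n ^ 3 ≤ 2 * T := by
    have : 6 * n ^ 2 ≤ n ^ 3 := by rw [pow_succ' n 2]; exact Nat.mul_le_mul_right _ hG
    omega
  have h5 : n ^ 4 * n ^ 2 ≤ n ^ 4 * (2592 * R * (Nat.log 2 n + 1)) := by
    calc n ^ 4 * n ^ 2 = (n ^ 3) ^ 2 := by ring
      _ ≤ (2 * T) ^ 2 := Nat.pow_le_pow_left h4 2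
      _ = 4 * T ^ 2 := by ring
      _ ≤ 4 * (R * (648 * n ^ 4 * (Nat.log 2 n + 1))) := Nat.mul_le_mul_left _ h3
      _ = _ := by ring
  exact Nat.le_of_mul_le_mul_left h5 (by positivity)

theorem succ_pow_five_le_two_pow (j : ℕ) : (j + 1) ^ 5 ≤ 1000 * 2 ^ j := by
  rcases le_total j 7 with h | h
  · interval_cases j <;> norm_num
  · induction j, h using Nat.le_induction with
    | base => norm_num
    | succ j hj ih =>
      have h1 : 8 * (j + 2) ≤ 9 * (j + 1) := by omega
      have h2 := Nat.pow_le_pow_left h1 5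
      rw [mul_pow, mul_pow] at h2
      rw [pow_succ 2 j, add_assoc]
      norm_num at h2 ⊢
      omega

/-- The logarithm is traded for a power: its fifth power costs one factor n, leaving |R| ≫ n^(9/5).
-/
theorem card_pow_nine_le_card_tripleRatios_pow_five {G : Finset ℝ} (hG : 6 ≤ G.card) :
    G.card ^ 9 ≤ 1000 * 2592 ^ 5 * (tripleRatios G).card ^ 5 := by
  have h1 := Nat.pow_le_pow_left (card_sq_le_card_tripleRatios_mul_log hG) 5
  have h2 : (Nat.log 2 G.card + 1) ^ 5 ≤ 1000 * G.card :=
    (succ_pow_five_le_two_pow _).trans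
      (Nat.mul_le_mul_left _ (Nat.pow_log_le_self 2 (Nat.ne_of_gt (Nat.lt_of_lt_of_le (by norm_num) hG))))
  refine le_of_mul_le_mul_left ?_ (show 0 < G.card from Nat.lt_of_lt_of_le (by norm_num) hG)
  calc G.card * G.card ^ 9 = (G.card ^ 2) ^ 5 := by ring
    _ ≤ _ := h1
    _ = (2592 * (tripleRatios G).card) ^ 5 * (Nat.log 2 G.card + 1) ^ 5 := by rw [mul_pow]
    _ ≤ (2592 * (tripleRatios G).card) ^ 5 * (1000 * G.card) := Nat.mul_le_mul_left _ h2
    _ = _ := by rw [mul_pow]; generalize (2592 : ℕ) ^ 5 = z; ring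

/-! ### Multiplicative inputs: Elekes and Plünnecke–Ruzsa. -/

/-- Elekes' argument: a set symmetric under `r ↦ 1 - r` has a large product set. -/
theorem card_pow_five_le_card_mul_self {R : Finset ℝ} (h0 : (0 : ℝ) ∉ R)
    (h1 : ∀ r ∈ R, 1 - r ∈ R) : R.card ^ 5 ≤ 81 * (R * R).card ^ 4 := by
  rcases lt_or_ge R.card 2 with h | h
  · have hle : R.card ≤ (R * R).card := by
      rcases R.eq_empty_or_nonempty with rfl | hne
      · simp
      · have := (hne.mul hne).card_pos
        omega
    interval_cases hc : R.card
    · simp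
    · have := Nat.pow_le_pow_left hle 4
      omega
  have hne0 : ∀ r ∈ R, r ≠ 0 := fun r hr h => h0 (h ▸ hr)
  -- The line y = a - (a/b) x contains (bc, a(1 - c)) for every c in R, so these |R|^2 lines are
  -- |R|-rich in RR × RR.
  let L := (R ×ˢ R).image (fun p : ℝ × ℝ => (-p.1 / p.2, p.1))
  have hL : L.card = R.card ^ 2 := by
    rw [Finset.card_image_of_injOn, Finset.card_product, sq]
    rintro ⟨a, b⟩ hp ⟨a', b'⟩ hp' heq
    simp only [Finset.coe_product, Set.mem_prod, Finset.mem_coe] at hp hp'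
    simp only [Prod.mk.injEq] at heq
    obtain ⟨he, rfl⟩ := heq
    have ha := hne0 _ hp.1
    have hb := hne0 _ hp.2
    have hb' := hne0 _ hp'.2
    rw [div_eq_div_iff hb hb'] at he
    have := mul_left_cancel₀ (neg_ne_zero.2 ha) he
    rw [this]
  have hrich := card_richLines_mul_cube_le (R * R) h L (by
    intro l hl
    rw [Finset.mem_image] at hl
    obtain ⟨⟨a, b⟩, hp, rfl⟩ := hl
    rw [Finset.mem_product] at hp
    have hb := hne0 _ hp.2
    refine Finset.card_le_card_of_injOn (fun c => b * c) ?_ ?_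
    · intro c hc
      rw [Finset.mem_coe, mem_gridLine]
      refine ⟨Finset.mul_mem_mul hp.2 hc, ?_⟩
      have : -a / b * (b * c) + a = a * (1 - c) := by field_simp; ring
      dsimp only
      rw [this]
      exact Finset.mul_mem_mul hp.1 (h1 c hc)
    · intro c _ c' _ hcc
      exact mul_left_cancel₀ hb hcc)
  rw [hL] at hrich
  calc R.card ^ 5 = R.card ^ 2 * R.card ^ 3 := by ring
    _ ≤ _ := hrich

/-- Plünnecke–Ruzsa for sets of nonzero reals. -/
theorem card_mul_div_mul_le {D : Finset ℝ} (h0 : (0 : ℝ) ∉ D) :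
    ((D * D) / (D * D)).card * D.card ^ 3 ≤ (D * D).card ^ 4 := by
  rcases D.eq_empty_or_nonempty with rfl | hD
  · simp
  -- Plünnecke–Ruzsa is a statement about groups, so D is lifted to the units.
  obtain ⟨U, rfl⟩ : ∃ U : Finset ℝˣ, D = U.image (Units.coeHom ℝ) := by
    refine ⟨D.preimage (Units.coeHom ℝ) (Function.Injective.injOn Units.val_injective), ?_⟩
    ext x
    rw [Finset.mem_image]
    constructor
    · intro hx
      exact ⟨Units.mk0 x (fun h => h0 (h ▸ hx)), Finset.mem_preimage.2 hx, rfl⟩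
    · rintro ⟨u, hu, rfl⟩
      exact Finset.mem_preimage.1 hu
  have hinj : Function.Injective (Units.coeHom ℝ) := Units.val_injective
  have hdiv : ∀ S T : Finset ℝˣ, (S / T).image (Units.coeHom ℝ)
      = S.image (Units.coeHom ℝ) / T.image (Units.coeHom ℝ) := by
    intro S T
    exact Finset.image_image₂_distrib fun a b => by simp
  rw [← Finset.image_mul, ← hdiv, Finset.card_image_of_injective _ hinj,
    Finset.card_image_of_injective _ hinj, Finset.card_image_of_injective _ hinj]
  have hU : U.Nonempty := Finset.image_nonempty.1 hD
  have h := Finset.pluennecke_ruzsa_inequality_pow_div_pow_mul hU U 2 2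
  rw [sq] at h
  have hpos : (0 : ℚ≥0) < U.card := by exact_mod_cast hU.card_pos
  have h' : (((U * U) / (U * U)).card : ℚ≥0) * U.card ^ 3 ≤ (U * U).card ^ 4 := by
    calc _ ≤ ((U * U).card / U.card : ℚ≥0) ^ (2 + 2) * U.card * U.card ^ 3 := by gcongr
      _ = ((U * U).card / U.card * U.card : ℚ≥0) ^ 4 := by ring
      _ = _ := by rw [div_mul_cancel₀ _ hpos.ne']
  exact_mod_cast h'

/-! ### Growth of the shifted ratio set. -/

/-- The nonzero elements of `G / G - 1`. -/
noncomputable def shiftedRatios (G : Finset ℝ) : Finset ℝ :=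
  ((G ×ˢ G).filter fun p => p.1 ≠ p.2).image fun p => p.1 / p.2 - 1

theorem mem_shiftedRatios {G : Finset ℝ} {x : ℝ} :
    x ∈ shiftedRatios G ↔ ∃ a ∈ G, ∃ b ∈ G, a ≠ b ∧ a / b - 1 = x := by
  simp only [shiftedRatios, Finset.mem_image, Finset.mem_filter, Finset.mem_product, Prod.exists]
  constructor
  · rintro ⟨a, b, ⟨⟨ha, hb⟩, h⟩, hx⟩; exact ⟨a, ha, b, hb, h, hx⟩
  · rintro ⟨a, ha, b, hb, h, hx⟩; exact ⟨a, b, ⟨⟨ha, hb⟩, h⟩, hx⟩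

theorem zero_notMem_shiftedRatios {G : Finset ℝ} (h0 : (0 : ℝ) ∉ G) :
    (0 : ℝ) ∉ shiftedRatios G := by
  rw [mem_shiftedRatios]
  rintro ⟨a, _, b, hb, hab, h⟩
  have hb0 : b ≠ 0 := fun h => h0 (h ▸ hb)
  rw [sub_eq_zero, div_eq_one_iff_eq hb0] at h
  exact hab h

theorem tripleRatios_subset_div {G : Finset ℝ} (h0 : (0 : ℝ) ∉ G) :
    tripleRatios G ⊆ shiftedRatios G / shiftedRatios G := by
  intro r hr
  rw [mem_tripleRatios] at hr
  obtain ⟨a, ha, b, hb, c, hc, h1, h2, -, rfl⟩ := hr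
  have hb0 : b ≠ 0 := fun h => h0 (h ▸ hb)
  have h3 : c - b ≠ 0 := sub_ne_zero.2 h2
  rw [Finset.mem_div]
  refine ⟨a / b - 1, mem_shiftedRatios.2 ⟨a, ha, b, hb, h1, rfl⟩, c / b - 1,
    mem_shiftedRatios.2 ⟨c, hc, b, hb, h2, rfl⟩, ?_⟩
  rw [div_sub_one hb0, div_sub_one hb0, div_div_div_cancel_right₀ hb0]

theorem card_shiftedRatios_le (G : Finset ℝ) : (shiftedRatios G).card ≤ G.card ^ 2 := by
  refine Finset.card_image_le.trans ((Finset.card_le_card (Finset.filter_subset _ _)).trans ?_)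
  rw [Finset.card_product, sq]

/-- With d = |D|, P = |RR|, M = |DD|: d^9 ≤ n^18 ≪ P^8 and P d^3 ≤ M^4, so d^33 ≪ (P d^3)^8 ≤ M^32.
For n < 6, d ≤ 25 and M ≥ 1 suffice. -/
theorem exists_card_shiftedRatios_pow_le : ∃ C : ℕ, 0 < C ∧ ∀ G : Finset ℝ, (0 : ℝ) ∉ G →
    (shiftedRatios G).card ^ 33 ≤ C * (shiftedRatios G * shiftedRatios G).card ^ 32 := by
  obtain ⟨c, hc⟩ : ∃ c : ℕ, c = 1000 * 2592 ^ 5 := ⟨_, rfl⟩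
  refine ⟨25 ^ 33 + (c * 81) ^ 2, by positivity, fun G h0 => ?_⟩
  have hd := card_shiftedRatios_le G
  have hPl := card_mul_div_mul_le (zero_notMem_shiftedRatios h0)
  have hRR : (tripleRatios G * tripleRatios G).card ≤
      ((shiftedRatios G * shiftedRatios G) / (shiftedRatios G * shiftedRatios G)).card := by
    refine Finset.card_le_card ?_
    rw [← div_mul_div_comm]
    exact Finset.mul_subset_mul (tripleRatios_subset_div h0) (tripleRatios_subset_div h0)
  have hE := card_pow_five_le_card_mul_self (zero_notMem_tripleRatios G)
    (fun r hr => one_sub_mem_tripleRatios hr)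
  have hPl' := (Nat.mul_le_mul_right _ hRR).trans hPl
  rcases (shiftedRatios G).eq_empty_or_nonempty with he | hne
  · simp [he]
  have hM : 0 < (shiftedRatios G * shiftedRatios G).card := (hne.mul hne).card_pos
  have hR := @card_pow_nine_le_card_tripleRatios_pow_five G
  rw [← hc] at hR
  generalize (shiftedRatios G * shiftedRatios G).card = M at *
  generalize (shiftedRatios G).card = d at *
  generalize (tripleRatios G * tripleRatios G).card = P at *
  generalize (tripleRatios G).card = R at *
  generalize G.card = n at *
  rw [add_mul]
  rcases lt_or_ge n 6 with hn | hn
  · refine le_trans ?_ (Nat.le_add_right _ _)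
    have h25 : d ≤ 25 := hd.trans (Nat.pow_le_pow_left (by omega : n ≤ 5) 2)
    calc d ^ 33 ≤ 25 ^ 33 * 1 := by rw [mul_one]; exact Nat.pow_le_pow_left h25 33
      _ ≤ 25 ^ 33 * M ^ 32 := Nat.mul_le_mul_left _ (Nat.one_le_pow _ _ hM)
  · refine le_trans ?_ (Nat.le_add_left _ _)
    have h1 : n ^ 9 ≤ c * 81 * P ^ 4 := by
      calc n ^ 9 ≤ c * R ^ 5 := hR hn
        _ ≤ c * (81 * P ^ 4) := Nat.mul_le_mul_left _ hE
        _ = _ := by ring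
    have h2 : d ^ 9 ≤ (c * 81) ^ 2 * P ^ 8 := by
      calc d ^ 9 ≤ (n ^ 2) ^ 9 := Nat.pow_le_pow_left hd 9
        _ = (n ^ 9) ^ 2 := by ring
        _ ≤ (c * 81 * P ^ 4) ^ 2 := Nat.pow_le_pow_left h1 2
        _ = _ := by ring
    calc d ^ 33 = d ^ 9 * d ^ 24 := by ring
      _ ≤ (c * 81) ^ 2 * P ^ 8 * d ^ 24 := Nat.mul_le_mul_right _ h2
      _ = (c * 81) ^ 2 * (P * d ^ 3) ^ 8 := by ring
      _ ≤ (c * 81) ^ 2 * (M ^ 4) ^ 8 := Nat.mul_le_mul_left _ (Nat.pow_le_pow_left hPl' 8)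
      _ = _ := by ring

/-! ### From finite sets to arbitrary B. -/

theorem shiftSet_eq_image (S : Set ℝ) (t : ℝ) : shiftSet S t = (fun s => s + t) '' S := by
  ext x
  simp only [shiftSet, Set.mem_ofPred_eq, Set.mem_image, eq_comm]

theorem encard_shiftSet (S : Set ℝ) (t : ℝ) : (shiftSet S t).encard = S.encard := by
  rw [shiftSet_eq_image]
  exact (add_left_injective t).encard_image S

/-- B/B adds at most the points 0 and 1 to D + 1, and D is nonempty, so those two are absorbed by
2|D|. -/
theorem encard_ratioSet_le {B : Set ℝ} {G : Finset ℝ} (hG : (G : Set ℝ) = B \ {0})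
    (hcard : 1 < G.card) : (ratioSet B).encard ≤ ((3 * (shiftedRatios G).card : ℕ) : ℕ∞) := by
  have hmem : ∀ x, x ∈ G ↔ x ∈ B ∧ x ≠ 0 := fun x => by
    rw [← Finset.mem_coe, hG]; rfl
  have hpos : 0 < (shiftedRatios G).card := by
    obtain ⟨a, ha, b, hb, hab⟩ := Finset.one_lt_card.1 hcard
    exact Finset.card_pos.2 ⟨_, mem_shiftedRatios.2 ⟨a, ha, b, hb, hab, rfl⟩⟩
  have hsub : ratioSet B ⊆
      (((shiftedRatios G).image (fun x => x + 1) ∪ {1, 0} : Finset ℝ) : Set ℝ) := by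
    rintro x ⟨a, ha, b, hb, hb0, rfl⟩
    rw [Finset.mem_coe, Finset.mem_union, Finset.mem_image]
    by_cases ha0 : a = 0
    · right; simp [ha0]
    by_cases hab : a = b
    · right; simp [hab, div_self hb0]
    · exact Or.inl ⟨a / b - 1, mem_shiftedRatios.2
        ⟨a, (hmem a).2 ⟨ha, ha0⟩, b, (hmem b).2 ⟨hb, hb0⟩, hab, rfl⟩, by ring⟩
  refine (Set.encard_le_encard hsub).trans ?_
  rw [Set.encard_coe_eq_coe_finsetCard, Nat.cast_le]
  refine (Finset.card_union_le _ _).trans ?_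
  have h1 := Finset.card_image_le (s := shiftedRatios G) (f := fun x => x + 1)
  have h2 : ({1, 0} : Finset ℝ).card ≤ 2 := Finset.card_le_two
  omega

theorem shiftedRatios_subset {B : Set ℝ} {G : Finset ℝ} (hG : (G : Set ℝ) = B \ {0}) :
    (shiftedRatios G : Set ℝ) ⊆ shiftSet (ratioSet B) (-1) := by
  intro x hx
  obtain ⟨a, ha, b, hb, -, rfl⟩ := mem_shiftedRatios.1 hx
  rw [← Finset.mem_coe, hG] at ha hb
  exact ⟨a / b, ⟨a, ha.1, b, hb.1, hb.2, rfl⟩, by ring⟩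

theorem infinite_mul_self {D : Set ℝ} (hD : D.Infinite) : (D * D).Infinite := by
  obtain ⟨x, hx, hx0⟩ := hD.exists_notMem_finset {0}
  rw [Finset.mem_singleton] at hx0
  refine (hD.image (f := fun y => x * y) (mul_right_injective₀ hx0).injOn).mono ?_
  rintro _ ⟨y, hy, rfl⟩
  exact Set.mul_mem_mul hx hy

theorem mul_rpow_le_of_pow_le {C q M : ℕ} (hC : 0 < C) (h : q ^ 33 ≤ C * M ^ 32) :
    ((C : ℝ) ^ (1 / 32 : ℝ))⁻¹ * (q : ℝ) ^ (1 + 1 / 32 : ℝ) ≤ M := by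
  have hC' : (0 : ℝ) < C := by exact_mod_cast hC
  rw [inv_mul_le_iff₀ (by positivity)]
  have h' : (q : ℝ) ^ 33 ≤ C * (M : ℝ) ^ 32 := by exact_mod_cast h
  refine le_of_pow_le_pow_left₀ (n := 32) (by norm_num) (by positivity) ?_
  rw [mul_pow, ← Real.rpow_natCast, ← Real.rpow_natCast ((C : ℝ) ^ _), ← Real.rpow_mul (by positivity),
    ← Real.rpow_mul (by positivity)]
  norm_num
  exact_mod_cast h

theorem exists_rpow_encard_ratioSet_le : ∃ c : ℝ, 0 < c ∧ ∃ K : ℝ, 0 < K ∧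
    ∀ B : Set ℝ, 1 < (B \ {0}).encard →
      ENNReal.ofReal K * ((ratioSet B).encard : ℝ≥0∞) ^ (1 + c) ≤
        ((shiftSet (ratioSet B) (-1) * shiftSet (ratioSet B) (-1)).encard : ℝ≥0∞) := by
  obtain ⟨C, hC, hmain⟩ := exists_card_shiftedRatios_pow_le
  -- The factor 3^33 pays for |B/B| ≤ 3|D|.
  refine ⟨1 / 32, by norm_num, (((3 ^ 33 * C : ℕ) : ℝ) ^ (1 / 32 : ℝ))⁻¹, by positivity, ?_⟩
  intro B hB
  rcases (ratioSet B).finite_or_infinite with hQ | hQ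
  swap
  · have hD : (shiftSet (ratioSet B) (-1)).Infinite := by
      rw [← Set.encard_eq_top_iff, encard_shiftSet, Set.encard_eq_top_iff]
      exact hQ
    rw [Set.encard_eq_top_iff.2 (infinite_mul_self hD)]
    exact le_top
  have hBfin : (B \ {0}).Finite := by
    obtain ⟨b, _, hb, _, _⟩ := Set.one_lt_encard_iff.1 hB
    have hb0 : b ≠ 0 := hb.2
    -- Division by a fixed nonzero b embeds B \ {0} in B/B.
    refine Set.Finite.of_finite_image (f := fun a => a / b) (hQ.subset ?_)
      fun x _ y _ h => (div_left_inj' hb0).1 h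
    rintro _ ⟨a, ha, rfl⟩
    exact ⟨a, ha.1, b, hb.1, hb0, rfl⟩
  obtain ⟨G, hG⟩ : ∃ G : Finset ℝ, (G : Set ℝ) = B \ {0} := ⟨hBfin.toFinset, hBfin.coe_toFinset⟩
  have h0 : (0 : ℝ) ∉ G := by rw [← Finset.mem_coe, hG]; simp
  have hcard : 1 < G.card := by
    rw [← hG, Set.encard_coe_eq_coe_finsetCard] at hB
    exact_mod_cast hB
  have hq := encard_ratioSet_le hG hcard
  have hM : ((shiftedRatios G * shiftedRatios G).card : ℕ∞)
      ≤ (shiftSet (ratioSet B) (-1) * shiftSet (ratioSet B) (-1)).encard := by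
    rw [← Set.encard_coe_eq_coe_finsetCard, Finset.coe_mul]
    exact Set.encard_le_encard (Set.mul_subset_mul (shiftedRatios_subset hG)
      (shiftedRatios_subset hG))
  rw [← hQ.cast_ncard_eq] at hq ⊢
  rw [Nat.cast_le] at hq
  have hpow : (ratioSet B).ncard ^ 33 ≤
      (3 ^ 33 * C) * (shiftedRatios G * shiftedRatios G).card ^ 32 := by
    refine (Nat.pow_le_pow_left hq 33).trans ?_
    rw [mul_pow, mul_assoc]
    exact Nat.mul_le_mul_left _ (hmain G h0)
  have hreal := mul_rpow_le_of_pow_le (by positivity) hpow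
  refine le_trans ?_ (ENat.toENNReal_le.2 hM)
  rw [ENat.toENNReal_coe, ENat.toENNReal_coe, ← ENNReal.ofReal_natCast (ratioSet B).ncard,
    ENNReal.ofReal_rpow_of_nonneg (Nat.cast_nonneg _) (by norm_num),
    ← ENNReal.ofReal_mul (by positivity), ← ENNReal.ofReal_natCast (shiftedRatios G * _).card]
  exact ENNReal.ofReal_le_ofReal hreal

theorem mainTheorem7 :
    (∃ ε : ℝ, 0 < ε ∧ ∃ N : ℕ, ∀ A : Finset ℝ, N ≤ A.card →
      ((A * A).card : ℝ) ≤ (A.card : ℝ) ^ (1 + ε) →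
      ¬ ∃ B : Set ℝ, 1 < (B \ {0}).encard ∧ shiftSet (A : Set ℝ) 1 = ratioSet B) ∧
    (∃ c : ℝ, 0 < c ∧ ∃ K : ℝ, 0 < K ∧ ∀ B : Set ℝ, 1 < (B \ {0}).encard →
      ENNReal.ofReal K * ((ratioSet B).encard : ℝ≥0∞) ^ (1 + c) ≤
        ((shiftSet (ratioSet B) (-1) * shiftSet (ratioSet B) (-1)).encard : ℝ≥0∞)) := by
  refine ⟨?_, exists_rpow_encard_ratioSet_le⟩
  obtain ⟨c, hc, K, hK, hmain⟩ := exists_rpow_encard_ratioSet_le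
  obtain ⟨x₀, hx₀⟩ := Filter.eventually_atTop.1
    ((tendsto_rpow_atTop (half_pos hc)).eventually_gt_atTop K⁻¹)
  -- Here A = B/B - 1, so (2) gives K|A|^(1+c) ≤ |AA| ≤ |A|^(1+c/2), impossible once K|A|^(c/2) > 1.
  -- The extra 1 ensures |A| > 0.
  refine ⟨c / 2, half_pos hc, ⌈x₀⌉₊ + 1, ?_⟩
  rintro A hA hAA ⟨B, hB, hAB⟩
  have hApos : (0 : ℝ) < A.card := by exact_mod_cast (by omega : 0 < A.card)
  have hlarge := hx₀ A.card ((Nat.le_ceil x₀).trans (by exact_mod_cast (by omega)))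
  have hshift : shiftSet (ratioSet B) (-1) = (A : Set ℝ) := by
    rw [← hAB, shiftSet_eq_image, shiftSet_eq_image, Set.image_image]
    simp
  have h := hmain B hB
  rw [hshift, ← hAB, encard_shiftSet, ← Finset.coe_mul, Set.encard_coe_eq_coe_finsetCard,
    Set.encard_coe_eq_coe_finsetCard, ENat.toENNReal_coe, ENat.toENNReal_coe,
    ← ENNReal.ofReal_natCast A.card, ENNReal.ofReal_rpow_of_nonneg hApos.le (by positivity),
    ← ENNReal.ofReal_mul hK.le, ← ENNReal.ofReal_natCast (A * A).card,
    ENNReal.ofReal_le_ofReal_iff (Nat.cast_nonneg _)] at h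
  have hsplit : (A.card : ℝ) ^ (1 + c) = (A.card : ℝ) ^ (1 + c / 2) * (A.card : ℝ) ^ (c / 2) := by
    rw [← Real.rpow_add hApos]; congr 1; ring
  have hP : (0 : ℝ) < (A.card : ℝ) ^ (1 + c / 2) := Real.rpow_pos_of_pos hApos _
  have h1 : 1 < K * (A.card : ℝ) ^ (c / 2) := by
    rwa [inv_lt_iff_one_lt_mul₀' hK] at hlarge
  rw [hsplit] at h
  nlinarith [mul_lt_mul_of_pos_left h1 hP]
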